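/- **Conventions.** All C*-algebras are complex, *-homomorphisms need not be unital unless stated, and ideals are two-sided. Let $A$ and $B$ be unital C*-algebras. - The full free product $A*B$ is the universal (not necessarily unital) C*-algebra generated by copies of $A$ and $B$ with no relations. The unital free product $A*_{\mathbb{C}}B$ is the universal C*-algebra generated by copies of $A$ and $B$ with a common unit. The (maximal) tensor product $A\otimes B$ is the universal C*-algebra generated by commuting copies of $A$ and $B$ with a common unit. (Here "a copy" means the image under a *-homomorphism, and $a\otimes 1$ and $1\otimes b$ denote the canonical images of $a\in A$ and $b\in B$ in $A\otimes B$.) The natural quotient maps $\pi:A*B\to A\otimes B$ and $\pi_1:A*_{\mathbb{C}}B\to A\otimes B$ are the *-homomorphisms sending the canonical image of $a\in A$ to $a\otimes 1$ and the canonical image of $b\in B$ to $1\otimes b$. - A separable C*-algebra $A$ is *semiprojective* if, whenever $D$ is a C*-algebra, $(J_n)_{n\in\mathbb{N}}$ is an increasing sequence of closed ideals of $D$, $J=\overline{\bigcup_n J_n}$, and $\phi:A\to D/J$ is a *-homomorphism, there are an $n$ and a *-homomorphism $\psi:A\to D/J_n$ whose composition with the quotient map $D/J_n\to D/J$ is $\phi$.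 - Two *-homomorphisms $\phi_0,\phi_1:A\to D$ are *homotopic* if there are *-homomorphisms $\phi_t:A\to D$ ($0\le t\le 1$), joining $\phi_0$ to $\phi_1$, such that $t\mapsto\phi_t(a)$ is norm-continuous for every $a\in A$. - $A$ *absorbs $B$ smoothly* if there is a *-isomorphism from $A$ onto $A\otimes B$ which is homotopic to the map $a\mapsto a\otimes 1$. **Theorem.** Let $A$ and $B$ be separable unital C*-algebras. If $A$ is semiprojective and absorbs $B$ smoothly, then 1. the quotient map $\pi:A*B\to A\otimes B$ splits, i.e. there is a *-homomorphism $\sigma:A\otimes B\to A*B$ with $\pi\circ\sigma=\mathrm{id}_{A\otimes B}$; and 2. the quotient map $\pi_1:A*_{\mathbb{C}}B\to A\otimes B$ splits unitally, i.e. there is a unital *-homomorphism $\sigma_1:A\otimes B\to A*_{\mathbb{C}}B$ with $\pi_1\circ\sigma_1=\mathrm{id}_{A\otimes B}$. -/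

import Mathlib

open scoped ENNReal

universe u

noncomputable section

/-! ## Quotients of C*-algebras by closed ideals, and semiprojectivity -/

/-- A closed two-sided ideal of a (not necessarily unital) C*-algebra. -/
structure ClosedIdeal (D : Type u) [NonUnitalCStarAlgebra D] extends Submodule ℂ D where
  mul_mem_left' : ∀ (d : D) {x : D}, x ∈ carrier → d * x ∈ carrier
  mul_mem_right' : ∀ (d : D) {x : D}, x ∈ carrier → x * d ∈ carrier
  isClosed' : IsClosed carrier

namespace ClosedIdeal

variable {D : Type u} [NonUnitalCStarAlgebra D]

/-- Closed two-sided ideals are ordered by inclusion. -/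
instance : LE (ClosedIdeal D) := ⟨fun I J => I.toSubmodule ≤ J.toSubmodule⟩

/-- A closed two-sided ideal of a C*-algebra is automatically self-adjoint. -/
theorem star_mem (J : ClosedIdeal D) {x : D} (hx : x ∈ J.toSubmodule) :
    star x ∈ J.toSubmodule := by
  let c : D := x * star x
  have hc : c ∈ J.toSubmodule := J.mul_mem_right' _ hx
  let S : NonUnitalStarSubalgebra ℂ D := NonUnitalStarAlgebra.elemental ℂ c
  have hcS : c ∈ S := NonUnitalStarAlgebra.elemental.self_mem ℂ c
  have hSJ : ∀ y ∈ S, y ∈ J.toSubmodule := by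
    intro y hy
    have hy' : y ∈ closure ((NonUnitalStarAlgebra.adjoin ℂ {c} :
        NonUnitalStarSubalgebra ℂ D) : Set D) := hy
    refine closure_minimal ?_ J.isClosed' hy'
    intro z hz
    have hz' : z ∈ NonUnitalStarAlgebra.adjoin ℂ ({c} : Set D) := hz
    rw [← NonUnitalStarSubalgebra.mem_toNonUnitalSubalgebra,
      NonUnitalStarAlgebra.adjoin_toNonUnitalSubalgebra] at hz'
    clear hz hy hy'
    induction hz' using NonUnitalAlgebra.adjoin_induction with
    | mem w hw =>
      have hsc : star c = c := by simp [c]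
      rcases hw with hw | hw
      · rw [Set.mem_singleton_iff.1 hw]; exact hc
      · have : w = c := by
          rw [← star_star w, Set.mem_singleton_iff.1 hw, hsc]
        rw [this]; exact hc
    | add a b _ _ ha hb => exact J.toSubmodule.add_mem ha hb
    | zero => exact J.toSubmodule.zero_mem
    | mul a b _ _ _ hb => exact J.mul_mem_left' a hb
    | smul r a _ ha => exact J.toSubmodule.smul_mem r ha
  let _ : PartialOrder S := CStarAlgebra.spectralOrder S
  have _ : StarOrderedRing S := CStarAlgebra.spectralOrderedRing S
  have happ := CStarAlgebra.increasingApproximateUnit S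
  set l := CStarAlgebra.approximateUnit S
  have _ : l.NeBot := happ.neBot
  have h1 : Filter.Tendsto (fun u : S => (⟨c, hcS⟩ : S) * u) l (nhds ⟨c, hcS⟩) :=
    happ.tendsto_mul_left _
  have h2 : Filter.Tendsto (fun u : S => ‖c - c * (u : D)‖) l (nhds 0) := by
    have h3 : Filter.Tendsto (fun u : S => c * (u : D)) l (nhds c) :=
      (continuous_subtype_val.tendsto _).comp h1
    have h4 := (tendsto_const_nhds (x := c)).sub h3
    simpa using h4.norm
  have h5 : Filter.Tendsto (fun u : S => star x * (u : D)) l (nhds (star x)) := by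
    rw [tendsto_iff_norm_sub_tendsto_zero]
    have hsq : Filter.Tendsto (fun u : S => Real.sqrt (2 * ‖c - c * (u : D)‖)) l (nhds 0) := by
      have := (h2.const_mul 2).sqrt
      simpa using this
    refine squeeze_zero' (Filter.Eventually.of_forall fun _ => norm_nonneg _) ?_ hsq
    filter_upwards [happ.eventually_norm] with u hu
    apply Real.le_sqrt_of_sq_le
    have key : star (star x * (u : D) - star x) * (star x * (u : D) - star x)
        = (c - c * (u : D)) - star (u : D) * (c - c * (u : D)) := by
      simp only [star_sub, star_mul, star_star, c]
      noncomm_ring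
    rw [sq, ← CStarRing.norm_star_mul_self, key]
    have hu' : ‖(u : D)‖ ≤ 1 := hu
    calc ‖(c - c * (u : D)) - star (u : D) * (c - c * (u : D))‖
        ≤ ‖c - c * (u : D)‖ + ‖star (u : D) * (c - c * (u : D))‖ := norm_sub_le _ _
      _ ≤ ‖c - c * (u : D)‖ + 1 * ‖c - c * (u : D)‖ := by
          gcongr
          refine (norm_mul_le _ _).trans ?_
          rw [norm_star]
          gcongr
      _ = 2 * ‖c - c * (u : D)‖ := by ring
  exact J.isClosed'.mem_of_tendsto h5
    (Filter.Eventually.of_forall fun u => J.mul_mem_left' _ (hSJ _ u.2))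

/-- The quotient *-algebra `D / J`.  A *-homomorphism between C*-algebras is an algebraic notion,
so only the *-algebra structure of the quotient is recorded. -/
def Quot (J : ClosedIdeal D) : Type u := D ⧸ J.toSubmodule

namespace Quot

variable (J : ClosedIdeal D)

instance : AddCommGroup J.Quot := inferInstanceAs (AddCommGroup (D ⧸ J.toSubmodule))

instance : Module ℂ J.Quot := inferInstanceAs (Module ℂ (D ⧸ J.toSubmodule))

/-- The class of `d` in `D / J`. -/
def of (d : D) : J.Quot := Submodule.Quotient.mk (p := J.toSubmodule) d

theorem of_eq_of {x y : D} : of J x = of J y ↔ x - y ∈ J.toSubmodule :=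
  Submodule.Quotient.eq J.toSubmodule

theorem of_surjective : Function.Surjective (of J) :=
  Submodule.Quotient.mk_surjective J.toSubmodule

theorem of_add (x y : D) : of J (x + y) = of J x + of J y := rfl

theorem of_zero : of J 0 = 0 := rfl

theorem of_smul (r : ℂ) (x : D) : of J (r • x) = r • of J x := rfl

instance : Mul J.Quot where
  mul := Quotient.map₂ (· * ·) (by
    intro a b hab c d hcd
    replace hab := (Submodule.quotientRel_def _).1 hab
    replace hcd := (Submodule.quotientRel_def _).1 hcd
    refine (Submodule.quotientRel_def _).2 ?_
    have : a * c - b * d = (a - b) * c + b * (c - d) := by noncomm_ring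
    rw [this]
    exact J.toSubmodule.add_mem (J.mul_mem_right' _ hab) (J.mul_mem_left' _ hcd))

theorem of_mul (x y : D) : of J (x * y) = of J x * of J y := rfl

instance : Star J.Quot where
  star := Quotient.map star (by
    intro a b hab
    replace hab := (Submodule.quotientRel_def _).1 hab
    refine (Submodule.quotientRel_def _).2 ?_
    rw [← star_sub]
    exact J.star_mem hab)

theorem of_star (x : D) : of J (star x) = star (of J x) := rfl

instance : NonUnitalRing J.Quot where
  __ := (inferInstance : AddCommGroup J.Quot)
  left_distrib a b c := by
    obtain ⟨a, rfl⟩ := of_surjective J a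
    obtain ⟨b, rfl⟩ := of_surjective J b
    obtain ⟨c, rfl⟩ := of_surjective J c
    simp only [← of_mul, ← of_add, mul_add]
  right_distrib a b c := by
    obtain ⟨a, rfl⟩ := of_surjective J a
    obtain ⟨b, rfl⟩ := of_surjective J b
    obtain ⟨c, rfl⟩ := of_surjective J c
    simp only [← of_mul, ← of_add, add_mul]
  zero_mul a := by
    obtain ⟨a, rfl⟩ := of_surjective J a
    simp only [← of_mul, ← of_zero, zero_mul]
  mul_zero a := by
    obtain ⟨a, rfl⟩ := of_surjective J a
    simp only [← of_mul, ← of_zero, mul_zero]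
  mul_assoc a b c := by
    obtain ⟨a, rfl⟩ := of_surjective J a
    obtain ⟨b, rfl⟩ := of_surjective J b
    obtain ⟨c, rfl⟩ := of_surjective J c
    simp only [← of_mul, mul_assoc]

end Quot

/-- The quotient map `D → D / J`. -/
def proj (J : ClosedIdeal D) : D →⋆ₙₐ[ℂ] J.Quot where
  toFun := Quot.of J
  map_smul' _ _ := rfl
  map_zero' := rfl
  map_add' _ _ := rfl
  map_mul' _ _ := rfl
  map_star' _ := rfl

theorem proj_eq_proj (J : ClosedIdeal D) {x y : D} : J.proj x = J.proj y ↔ x - y ∈ J.toSubmodule :=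
  Quot.of_eq_of J

theorem proj_surjective (J : ClosedIdeal D) : Function.Surjective J.proj :=
  Quot.of_surjective J

/-- The quotient map `D / I → D / J` for closed ideals `I ⊆ J`. -/
def factor (I J : ClosedIdeal D) (h : I ≤ J) : I.Quot →⋆ₙₐ[ℂ] J.Quot where
  toFun := Submodule.factor (show I.toSubmodule ≤ J.toSubmodule from h)
  map_smul' r x := map_smul (Submodule.factor (show I.toSubmodule ≤ J.toSubmodule from h)) r x
  map_zero' := map_zero (Submodule.factor (show I.toSubmodule ≤ J.toSubmodule from h))
  map_add' x y := map_add (Submodule.factor (show I.toSubmodule ≤ J.toSubmodule from h)) x y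
  map_mul' x y := by
    obtain ⟨x, rfl⟩ := Quot.of_surjective I x
    obtain ⟨y, rfl⟩ := Quot.of_surjective I y
    rfl
  map_star' x := by
    obtain ⟨x, rfl⟩ := Quot.of_surjective I x
    rfl

theorem factor_proj (I J : ClosedIdeal D) (h : I ≤ J) (d : D) :
    factor I J h (I.proj d) = J.proj d := rfl

/-- The closure `J = [⋃ₙ Jₙ]⁻` of the union of an increasing sequence of closed ideals. -/
def closureUnion (J : ℕ → ClosedIdeal D) (hJ : ∀ m n, m ≤ n → J m ≤ J n) : ClosedIdeal D where
  __ := (⨆ n, (J n).toSubmodule).topologicalClosure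
  mul_mem_left' d x hx := by
    have hmono : Monotone fun n => (J n).toSubmodule := fun m n h => hJ m n h
    refine map_mem_closure (f := fun y => d * y) (continuous_const_mul d) hx ?_
    intro y hy
    obtain ⟨n, hn⟩ := (Submodule.mem_iSup_of_directed _ hmono.directed_le).1 hy
    exact (Submodule.mem_iSup_of_directed _ hmono.directed_le).2
      ⟨n, (J n).mul_mem_left' d hn⟩
  mul_mem_right' d x hx := by
    have hmono : Monotone fun n => (J n).toSubmodule := fun m n h => hJ m n h
    refine map_mem_closure (f := fun y => y * d) (continuous_mul_const d) hx ?_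
    intro y hy
    obtain ⟨n, hn⟩ := (Submodule.mem_iSup_of_directed _ hmono.directed_le).1 hy
    exact (Submodule.mem_iSup_of_directed _ hmono.directed_le).2
      ⟨n, (J n).mul_mem_right' d hn⟩
  isClosed' := Submodule.isClosed_topologicalClosure _

theorem coe_closureUnion (J : ℕ → ClosedIdeal D) (hJ : ∀ m n, m ≤ n → J m ≤ J n) :
    ((closureUnion J hJ).toSubmodule : Set D) = closure (⋃ n, ((J n).toSubmodule : Set D)) := by
  have hmono : Monotone fun n => (J n).toSubmodule := fun m n h => hJ m n h
  rw [← Submodule.coe_iSup_of_directed _ hmono.directed_le]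
  rfl

theorem le_closureUnion (J : ℕ → ClosedIdeal D) (hJ : ∀ m n, m ≤ n → J m ≤ J n) (n : ℕ) :
    J n ≤ closureUnion J hJ :=
  (le_iSup (fun n => (J n).toSubmodule) n).trans (Submodule.le_topologicalClosure _)

end ClosedIdeal

/-- A separable C*-algebra `A` is semiprojective if, for every C*-algebra `D`, every increasing
sequence `Jₙ` of closed ideals of `D` with `J = [⋃ Jₙ]⁻`, and every *-homomorphism
`φ : A → D / J`, there are `n` and a *-homomorphism `ψ : A → D / Jₙ` lifting `φ`. -/
def IsSemiprojective (A : Type u) [NonUnitalCStarAlgebra A] : Prop :=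
  TopologicalSpace.SeparableSpace A ∧
  ∀ (D : Type u) [NonUnitalCStarAlgebra D] (J : ℕ → ClosedIdeal D)
    (hJ : ∀ m n, m ≤ n → J m ≤ J n)
    (φ : A →⋆ₙₐ[ℂ] (ClosedIdeal.closureUnion J hJ).Quot),
    ∃ (n : ℕ) (ψ : A →⋆ₙₐ[ℂ] (J n).Quot),
      (ClosedIdeal.factor (J n) (ClosedIdeal.closureUnion J hJ)
        (ClosedIdeal.le_closureUnion J hJ n)).comp ψ = φ

/-! ## The universal C*-algebra generated by two C*-algebras subject to relations -/

/-- A condition on pairs of *-homomorphisms from `A` and `B` into a common C*-algebra. -/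
def PairRelation (A B : Type u) [NonUnitalCStarAlgebra A] [NonUnitalCStarAlgebra B] :
    Type (u + 1) :=
  ∀ (D : Type u) [NonUnitalCStarAlgebra D], (A →⋆ₙₐ[ℂ] D) → (B →⋆ₙₐ[ℂ] D) → Prop

/-- Formal *-polynomials, without constant term, in the elements of `A` and `B`. -/
inductive PairTerm (A B : Type u) : Type u
  | inl : A → PairTerm A B
  | inr : B → PairTerm A B
  | zero : PairTerm A B
  | add : PairTerm A B → PairTerm A B → PairTerm A B
  | mul : PairTerm A B → PairTerm A B → PairTerm A B
  | smul : ℂ → PairTerm A B → PairTerm A B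

namespace PairTerm

variable {A B : Type u} [NonUnitalCStarAlgebra A] [NonUnitalCStarAlgebra B]

/-- The value of a formal *-polynomial under a pair of *-homomorphisms.  Adjoints need not be
formed explicitly, since the generating set is closed under them. -/
def eval {D : Type u} [NonUnitalCStarAlgebra D] (φ : A →⋆ₙₐ[ℂ] D) (ψ : B →⋆ₙₐ[ℂ] D) :
    PairTerm A B → D
  | inl a => φ a
  | inr b => ψ b
  | zero => 0
  | add s t => eval φ ψ s + eval φ ψ t
  | mul s t => eval φ ψ s * eval φ ψ t
  | smul r t => r • eval φ ψ t

theorem map_eval {D E : Type u} [NonUnitalCStarAlgebra D] [NonUnitalCStarAlgebra E]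
    (φ : A →⋆ₙₐ[ℂ] D) (ψ : B →⋆ₙₐ[ℂ] D) (f : D →⋆ₙₐ[ℂ] E) (t : PairTerm A B) :
    f (eval φ ψ t) = eval (f.comp φ) (f.comp ψ) t := by
  induction t with
  | inl a => rfl
  | inr b => rfl
  | zero => exact map_zero f
  | add s t hs ht => simp only [eval, map_add, hs, ht]
  | mul s t hs ht => simp only [eval, map_mul, hs, ht]
  | smul r t ht => simp only [eval, map_smul, ht]

theorem exists_eval_eq {D : Type u} [NonUnitalCStarAlgebra D] (φ : A →⋆ₙₐ[ℂ] D)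
    (ψ : B →⋆ₙₐ[ℂ] D) {x : D}
    (hx : x ∈ NonUnitalStarAlgebra.adjoin ℂ (Set.range φ ∪ Set.range ψ)) :
    ∃ t : PairTerm A B, eval φ ψ t = x := by
  rw [← NonUnitalStarSubalgebra.mem_toNonUnitalSubalgebra,
    NonUnitalStarAlgebra.adjoin_toNonUnitalSubalgebra] at hx
  induction hx using NonUnitalAlgebra.adjoin_induction with
  | mem w hw =>
    rcases hw with (⟨a, rfl⟩ | ⟨b, rfl⟩) | (⟨a, ha⟩ | ⟨b, hb⟩)
    · exact ⟨inl a, rfl⟩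
    · exact ⟨inr b, rfl⟩
    · exact ⟨inl (star a), by simp only [eval, map_star, ha, star_star]⟩
    · exact ⟨inr (star b), by simp only [eval, map_star, hb, star_star]⟩
  | add a b _ _ ha hb =>
    obtain ⟨s, rfl⟩ := ha
    obtain ⟨t, rfl⟩ := hb
    exact ⟨add s t, rfl⟩
  | zero => exact ⟨zero, rfl⟩
  | mul a b _ _ ha hb =>
    obtain ⟨s, rfl⟩ := ha
    obtain ⟨t, rfl⟩ := hb
    exact ⟨mul s t, rfl⟩
  | smul r a _ ha =>
    obtain ⟨s, rfl⟩ := ha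
    exact ⟨smul r s, rfl⟩

end PairTerm

section Universal

variable {A B : Type u} [NonUnitalCStarAlgebra A] [NonUnitalCStarAlgebra B]

/-- The set of all C*-seminorms on formal *-polynomials which come from a pair of
*-homomorphisms satisfying the relation `R`.  (Pairs of *-homomorphisms themselves form a proper
class; up to equivalence of the generated C*-algebras they are classified by this set.) -/
def PairSeminorm (R : PairRelation A B) : Type u :=
  {p : PairTerm A B → ℝ // ∃ (D : Type u) (_ : NonUnitalCStarAlgebra D) (φ : A →⋆ₙₐ[ℂ] D)
    (ψ : B →⋆ₙₐ[ℂ] D), R D φ ψ ∧ ∀ t, p t = ‖PairTerm.eval φ ψ t‖}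

namespace PairSeminorm

variable {R : PairRelation A B} (p : PairSeminorm R)

/-- A C*-algebra carrying a pair of *-homomorphisms that induces the seminorm `p`. -/
def Target : Type u := p.2.choose

instance : NonUnitalCStarAlgebra p.Target := p.2.choose_spec.choose

/-- The *-homomorphism from `A` in a pair inducing `p`. -/
def left : A →⋆ₙₐ[ℂ] p.Target := p.2.choose_spec.choose_spec.choose

/-- The *-homomorphism from `B` in a pair inducing `p`. -/
def right : B →⋆ₙₐ[ℂ] p.Target := p.2.choose_spec.choose_spec.choose_spec.choose

theorem rel : R p.Target p.left p.right :=
  p.2.choose_spec.choose_spec.choose_spec.choose_spec.1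

theorem apply_eq (t : PairTerm A B) : p.1 t = ‖PairTerm.eval p.left p.right t‖ :=
  p.2.choose_spec.choose_spec.choose_spec.choose_spec.2 t

end PairSeminorm

/-- The family of *-homomorphisms `C → D i` as a *-homomorphism into the `ℓ^∞` direct product. -/
def lpPi {I C : Type u} {D : I → Type u} [NonUnitalCStarAlgebra C]
    [∀ i, NonUnitalCStarAlgebra (D i)] (f : ∀ i, C →⋆ₙₐ[ℂ] D i) : C →⋆ₙₐ[ℂ] lp D ∞ where
  toFun c := ⟨fun i => f i c, memℓp_infty ⟨‖c‖, by
    rintro _ ⟨i, rfl⟩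
    exact NonUnitalStarAlgHom.norm_apply_le (f i) c⟩⟩
  map_smul' r c := by ext i; exact map_smul (f i) r c
  map_zero' := by ext i; exact map_zero (f i)
  map_add' c d := by ext i; exact map_add (f i) c d
  map_mul' c d := by ext i; exact map_mul (f i) c d
  map_star' c := by ext i; exact map_star (f i) c

/-- Evaluation at a coordinate of the `ℓ^∞` direct product. -/
def lpEval {I : Type u} (D : I → Type u) [∀ i, NonUnitalCStarAlgebra (D i)] (i : I) :
    lp D ∞ →⋆ₙₐ[ℂ] D i where
  toFun x := x i
  map_smul' _ _ := rfl
  map_zero' := rfl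
  map_add' _ _ := rfl
  map_mul' _ _ := rfl
  map_star' _ := rfl

/-- The closed *-subalgebra generated by the images of two *-homomorphisms. -/
def generatedBy {D : Type u} [NonUnitalCStarAlgebra D] (φ : A →⋆ₙₐ[ℂ] D) (ψ : B →⋆ₙₐ[ℂ] D) :
    NonUnitalStarSubalgebra ℂ D :=
  (NonUnitalStarAlgebra.adjoin ℂ (Set.range φ ∪ Set.range ψ)).topologicalClosure

instance {D : Type u} [NonUnitalCStarAlgebra D] (φ : A →⋆ₙₐ[ℂ] D) (ψ : B →⋆ₙₐ[ℂ] D) :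
    IsClosed (generatedBy φ ψ : Set D) :=
  NonUnitalStarSubalgebra.isClosed_topologicalClosure _

/-- The universal C*-algebra generated by copies of `A` and `B` subject to the relation `R`: the
C*-algebra generated by `A` and `B` in the direct product of all pairs satisfying `R`. -/
def UniversalPair (R : PairRelation A B) : Type u :=
  generatedBy (lpPi fun p : PairSeminorm R => p.left) (lpPi fun p : PairSeminorm R => p.right)

namespace UniversalPair

variable (R : PairRelation A B)

instance : NonUnitalCStarAlgebra (UniversalPair R) :=
  inferInstanceAs (NonUnitalCStarAlgebra (generatedBy
    (lpPi fun p : PairSeminorm R => p.left) (lpPi fun p : PairSeminorm R => p.right)))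

/-- The canonical map of `A` into the universal C*-algebra. -/
def inl : A →⋆ₙₐ[ℂ] UniversalPair R :=
  NonUnitalStarAlgHom.codRestrict (lpPi fun p : PairSeminorm R => p.left) (generatedBy _ _)
    fun a => NonUnitalStarSubalgebra.le_topologicalClosure _
      (NonUnitalStarAlgebra.subset_adjoin ℂ _ (Or.inl ⟨a, rfl⟩))

/-- The canonical map of `B` into the universal C*-algebra. -/
def inr : B →⋆ₙₐ[ℂ] UniversalPair R :=
  NonUnitalStarAlgHom.codRestrict (lpPi fun p : PairSeminorm R => p.right) (generatedBy _ _)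
    fun b => NonUnitalStarSubalgebra.le_topologicalClosure _
      (NonUnitalStarAlgebra.subset_adjoin ℂ _ (Or.inr ⟨b, rfl⟩))

/-- The coordinate projection belonging to one of the pairs satisfying `R`. -/
def coord (p : PairSeminorm R) : UniversalPair R →⋆ₙₐ[ℂ] p.Target :=
  (lpEval (fun p : PairSeminorm R => p.Target) p).comp
    (NonUnitalStarSubalgebraClass.subtype (generatedBy
      (lpPi fun p : PairSeminorm R => p.left) (lpPi fun p : PairSeminorm R => p.right)))

theorem coord_inl (p : PairSeminorm R) : (coord R p).comp (inl R) = p.left := rfl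

theorem coord_inr (p : PairSeminorm R) : (coord R p).comp (inr R) = p.right := rfl

variable {R}

theorem coord_ext {x y : UniversalPair R} (h : ∀ p, coord R p x = coord R p y) : x = y := by
  apply Subtype.ext
  ext p
  exact h p

/-- The images of `A` and `B` generate the universal C*-algebra. -/
theorem closed_induction {P : UniversalPair R → Prop} (hP : IsClosed {x | P x})
    (h : ∀ t, P (PairTerm.eval (inl R) (inr R) t)) (x : UniversalPair R) : P x := by
  have hx : x.1 ∈ closure
      ((NonUnitalStarAlgebra.adjoin ℂ (Set.range (lpPi fun p : PairSeminorm R => p.left) ∪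
        Set.range (lpPi fun p : PairSeminorm R => p.right)) :
        NonUnitalStarSubalgebra ℂ (lp (fun p : PairSeminorm R => p.Target) ∞)) :
        Set (lp (fun p : PairSeminorm R => p.Target) ∞)) := x.2
  have hx' : x ∈ closure {y : UniversalPair R | ∃ t, PairTerm.eval (inl R) (inr R) t = y} := by
    refine (Topology.IsInducing.subtypeVal.closure_eq_preimage_closure_image _).ge ?_
    refine closure_mono ?_ hx
    intro z hz
    obtain ⟨t, rfl⟩ := PairTerm.exists_eval_eq _ _ hz
    refine ⟨PairTerm.eval (inl R) (inr R) t, ⟨t, rfl⟩, ?_⟩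
    exact PairTerm.map_eval (inl R) (inr R) (NonUnitalStarSubalgebraClass.subtype (generatedBy
      (lpPi fun p : PairSeminorm R => p.left) (lpPi fun p : PairSeminorm R => p.right))) t
  refine closure_minimal ?_ hP hx'
  rintro _ ⟨t, rfl⟩
  exact h t

theorem _root_.NonUnitalStarAlgHom.continuous_of_cstar {C D : Type u} [NonUnitalCStarAlgebra C]
    [NonUnitalCStarAlgebra D] (f : C →⋆ₙₐ[ℂ] D) : Continuous f :=
  AddMonoidHomClass.continuous_of_bound f 1 fun x => by
    simpa using NonUnitalStarAlgHom.norm_apply_le f x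

theorem hom_ext {D : Type u} [NonUnitalCStarAlgebra D] {f g : UniversalPair R →⋆ₙₐ[ℂ] D}
    (hl : f.comp (inl R) = g.comp (inl R)) (hr : f.comp (inr R) = g.comp (inr R)) : f = g := by
  ext x
  refine closed_induction (P := fun x => f x = g x)
    (isClosed_eq (NonUnitalStarAlgHom.continuous_of_cstar f)
      (NonUnitalStarAlgHom.continuous_of_cstar g)) (fun t => ?_) x
  rw [PairTerm.map_eval, PairTerm.map_eval, hl, hr]

section Lift

variable {D : Type u} [NonUnitalCStarAlgebra D] (φ : A →⋆ₙₐ[ℂ] D) (ψ : B →⋆ₙₐ[ℂ] D)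

theorem norm_eval_le (h : R D φ ψ) (t : PairTerm A B) :
    ‖PairTerm.eval φ ψ t‖ ≤ ‖PairTerm.eval (inl R) (inr R) t‖ := by
  let p : PairSeminorm R := ⟨fun t => ‖PairTerm.eval φ ψ t‖, D, inferInstance, φ, ψ, h, fun _ => rfl⟩
  calc ‖PairTerm.eval φ ψ t‖ = ‖PairTerm.eval p.left p.right t‖ := p.apply_eq t
    _ = ‖coord R p (PairTerm.eval (inl R) (inr R) t)‖ := by
        rw [PairTerm.map_eval, coord_inl, coord_inr]
    _ ≤ _ := NonUnitalStarAlgHom.norm_apply_le _ _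

/-- The graph of the homomorphism determined by `φ` and `ψ`. -/
def liftGraph : NonUnitalStarSubalgebra ℂ (UniversalPair R × D) :=
  generatedBy ((inl R).prod φ) ((inr R).prod ψ)

instance : NonUnitalCStarAlgebra (liftGraph (R := R) φ ψ) :=
  inferInstanceAs (NonUnitalCStarAlgebra (generatedBy ((inl R).prod φ) ((inr R).prod ψ)))

/-- The projection of the graph to the universal C*-algebra. -/
def liftGraphFst : liftGraph (R := R) φ ψ →⋆ₙₐ[ℂ] UniversalPair R :=
  (NonUnitalStarAlgHom.fst ℂ (UniversalPair R) D).comp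
    (NonUnitalStarSubalgebraClass.subtype (liftGraph (R := R) φ ψ))

/-- The projection of the graph to the target. -/
def liftGraphSnd : liftGraph (R := R) φ ψ →⋆ₙₐ[ℂ] D :=
  (NonUnitalStarAlgHom.snd ℂ (UniversalPair R) D).comp
    (NonUnitalStarSubalgebraClass.subtype (liftGraph (R := R) φ ψ))

theorem eval_mem_liftGraph (t : PairTerm A B) :
    (PairTerm.eval (inl R) (inr R) t, PairTerm.eval φ ψ t) ∈ liftGraph (R := R) φ ψ := by
  have hsub : ∀ z ∈ Set.range ((inl R).prod φ) ∪ Set.range ((inr R).prod ψ),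
      z ∈ liftGraph (R := R) φ ψ := fun z hz =>
    subset_closure (NonUnitalStarAlgebra.subset_adjoin ℂ _ hz)
  induction t with
  | inl a => exact hsub _ (Or.inl ⟨a, rfl⟩)
  | inr b => exact hsub _ (Or.inr ⟨b, rfl⟩)
  | zero => exact zero_mem (liftGraph (R := R) φ ψ)
  | add s t hs ht => exact add_mem hs ht
  | mul s t hs ht => exact mul_mem hs ht
  | smul r t ht => exact SMulMemClass.smul_mem r ht

theorem norm_snd_le (h : R D φ ψ) {x : UniversalPair R × D} (hx : x ∈ liftGraph (R := R) φ ψ) :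
    ‖x.2‖ ≤ ‖x.1‖ := by
  refine closure_minimal (t := {x : UniversalPair R × D | ‖x.2‖ ≤ ‖x.1‖}) ?_
    (isClosed_le continuous_snd.norm continuous_fst.norm) hx
  intro z hz
  obtain ⟨t, rfl⟩ := PairTerm.exists_eval_eq _ _ hz
  have h1 := PairTerm.map_eval ((inl R).prod φ) ((inr R).prod ψ)
    (NonUnitalStarAlgHom.fst ℂ (UniversalPair R) D) t
  have h2 := PairTerm.map_eval ((inl R).prod φ) ((inr R).prod ψ)
    (NonUnitalStarAlgHom.snd ℂ (UniversalPair R) D) t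
  rw [NonUnitalStarAlgHom.fst_prod, NonUnitalStarAlgHom.fst_prod] at h1
  rw [NonUnitalStarAlgHom.snd_prod, NonUnitalStarAlgHom.snd_prod] at h2
  have h3 := norm_eval_le φ ψ h t
  rw [← h1, ← h2] at h3
  exact h3

theorem liftGraphFst_bijective (h : R D φ ψ) :
    Function.Bijective (liftGraphFst (R := R) φ ψ) := by
  have hiso : Isometry (liftGraphFst (R := R) φ ψ) := by
    refine AddMonoidHomClass.isometry_of_norm _ fun x => ?_
    have := norm_snd_le φ ψ h x.2
    exact (max_eq_left this).symm
  refine ⟨hiso.injective, fun x => ?_⟩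
  refine closed_induction (P := fun x => x ∈ Set.range (liftGraphFst (R := R) φ ψ))
    hiso.isClosedEmbedding.isClosed_range (fun t => ?_) x
  exact ⟨⟨_, eval_mem_liftGraph φ ψ t⟩, rfl⟩

/-- The universal property: *-homomorphisms `φ : A → D` and `ψ : B → D` satisfying the relation
extend to the universal C*-algebra. -/
def lift (h : R D φ ψ) : UniversalPair R →⋆ₙₐ[ℂ] D :=
  (liftGraphSnd (R := R) φ ψ).comp
    (StarAlgEquiv.ofBijective (R := ℂ) (liftGraphFst (R := R) φ ψ)
      (liftGraphFst_bijective φ ψ h)).symm.toNonUnitalStarAlgHom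

theorem lift_eval (h : R D φ ψ) (t : PairTerm A B) :
    lift φ ψ h (PairTerm.eval (inl R) (inr R) t) = PairTerm.eval φ ψ t := by
  have : (StarAlgEquiv.ofBijective (R := ℂ) (liftGraphFst (R := R) φ ψ)
      (liftGraphFst_bijective φ ψ h)).symm (PairTerm.eval (inl R) (inr R) t)
      = ⟨_, eval_mem_liftGraph φ ψ t⟩ := by
    rw [StarAlgEquiv.symm_apply_eq]
    rfl
  exact congrArg (liftGraphSnd (R := R) φ ψ) this

theorem lift_inl (h : R D φ ψ) (a : A) : lift φ ψ h (inl R a) = φ a :=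
  lift_eval φ ψ h (PairTerm.inl a)

theorem lift_inr (h : R D φ ψ) (b : B) : lift φ ψ h (inr R b) = ψ b :=
  lift_eval φ ψ h (PairTerm.inr b)

end Lift

end UniversalPair

end Universal

section Unital

variable {A B : Type u} [CStarAlgebra A] [CStarAlgebra B]

theorem UniversalPair.unit_mul {R : PairRelation A B}
    (h : UniversalPair.inl R 1 = UniversalPair.inr R 1) (x : UniversalPair R) :
    UniversalPair.inl R 1 * x = x ∧ x * UniversalPair.inl R 1 = x := by
  refine UniversalPair.closed_induction
    (P := fun x => UniversalPair.inl R 1 * x = x ∧ x * UniversalPair.inl R 1 = x) ?_ ?_ x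
  · exact (isClosed_eq (continuous_const_mul _) continuous_id).inter
      (isClosed_eq (continuous_mul_const _) continuous_id)
  · intro t
    induction t with
    | inl a => simp only [PairTerm.eval, ← map_mul, one_mul, mul_one, and_self]
    | inr b => rw [h]; simp only [PairTerm.eval, ← map_mul, one_mul, mul_one, and_self]
    | zero => simp only [PairTerm.eval, mul_zero, zero_mul, and_self]
    | add s t hs ht => simp only [PairTerm.eval, mul_add, add_mul, hs, ht, and_self]
    | mul s t hs ht =>
      exact ⟨by rw [PairTerm.eval, ← mul_assoc, hs.1], by rw [PairTerm.eval, mul_assoc, ht.2]⟩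
    | smul r t ht =>
      simp only [PairTerm.eval, mul_smul_comm, smul_mul_assoc, ht, and_self]

/-- If the images of the two units agree, they form a unit of the universal C*-algebra. -/
@[reducible] def UniversalPair.normedRing (R : PairRelation A B)
    (h : UniversalPair.inl R 1 = UniversalPair.inr R 1) : NormedRing (UniversalPair R) where
  __ := (inferInstance : NonUnitalNormedRing (UniversalPair R))
  one := UniversalPair.inl R 1
  one_mul x := (UniversalPair.unit_mul h x).1
  mul_one x := (UniversalPair.unit_mul h x).2

/-- The unital C*-algebra structure with this unit. -/
@[reducible] def UniversalPair.cstarAlgebra (R : PairRelation A B)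
    (h : UniversalPair.inl R 1 = UniversalPair.inr R 1) : CStarAlgebra (UniversalPair R) :=
  letI N : NonUnitalCStarAlgebra (UniversalPair R) := inferInstance
  letI M : Module ℂ (UniversalPair R) := inferInstance
  letI r : NormedRing (UniversalPair R) := UniversalPair.normedRing R h
  letI alg : Algebra ℂ (UniversalPair R) :=
    { M with
      algebraMap :=
        { toFun := fun r => r • (1 : UniversalPair R)
          map_one' := one_smul _ _
          map_mul' := fun r s => by
            rw [smul_mul_smul_comm, one_mul]
          map_zero' := zero_smul _ _
          map_add' := fun r s => add_smul _ _ _ }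
      commutes' := fun r x => by
        change (r • (1 : UniversalPair R)) * x = x * (r • (1 : UniversalPair R))
        rw [smul_mul_assoc, mul_smul_comm, one_mul, mul_one]
      smul_def' := fun r x => by
        change r • x = (r • (1 : UniversalPair R)) * x
        rw [smul_mul_assoc, one_mul] }
  { r, alg, N with
    norm_smul_le := N.norm_smul_le }

end Unital

/-! ## Free products and the maximal tensor product -/

section Products

variable (A B : Type u) [CStarAlgebra A] [CStarAlgebra B]

/-- No relation at all. -/
def noRelation : PairRelation A B := fun _ _ _ _ => True

/-- The relation "the copies of `A` and `B` have a common unit". -/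
def commonUnit : PairRelation A B := fun _ _ φ ψ => φ 1 = ψ 1

/-- The relation "the copies of `A` and `B` commute and have a common unit". -/
def commuteCommonUnit : PairRelation A B :=
  fun _ _ φ ψ => φ 1 = ψ 1 ∧ ∀ a b, φ a * ψ b = ψ b * φ a

/-- The full free product `A * B`: the universal C*-algebra generated by copies of `A` and `B`
with no relations. -/
def FreeProduct : Type u := UniversalPair (noRelation A B)

/-- The full unital free product `A *_ℂ B`: the universal C*-algebra generated by copies of `A`
and `B` with a common unit. -/
def UnitalFreeProduct : Type u := UniversalPair (commonUnit A B)

/-- The maximal tensor product `A ⊗ B`: the universal C*-algebra generated by commuting copies of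
`A` and `B` with a common unit. -/
def MaxTensorProduct : Type u := UniversalPair (commuteCommonUnit A B)

instance : NonUnitalCStarAlgebra (FreeProduct A B) :=
  inferInstanceAs (NonUnitalCStarAlgebra (UniversalPair (noRelation A B)))

theorem commonUnit_inl_inr : UniversalPair.inl (commonUnit A B) 1 =
    UniversalPair.inr (commonUnit A B) 1 :=
  UniversalPair.coord_ext fun p => p.rel

theorem commuteCommonUnit_inl_inr : UniversalPair.inl (commuteCommonUnit A B) 1 =
    UniversalPair.inr (commuteCommonUnit A B) 1 :=
  UniversalPair.coord_ext fun p => p.rel.1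

instance : CStarAlgebra (UnitalFreeProduct A B) :=
  UniversalPair.cstarAlgebra (commonUnit A B) (commonUnit_inl_inr A B)

instance : CStarAlgebra (MaxTensorProduct A B) :=
  UniversalPair.cstarAlgebra (commuteCommonUnit A B) (commuteCommonUnit_inl_inr A B)

namespace FreeProduct

/-- The canonical *-homomorphism `A → A * B`. -/
def inl : A →⋆ₙₐ[ℂ] FreeProduct A B := UniversalPair.inl (noRelation A B)

/-- The canonical *-homomorphism `B → A * B`. -/
def inr : B →⋆ₙₐ[ℂ] FreeProduct A B := UniversalPair.inr (noRelation A B)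

variable {A B}

/-- The homomorphism on `A * B` determined by its restrictions to `A` and `B`. -/
def lift {D : Type u} [NonUnitalCStarAlgebra D] (φ : A →⋆ₙₐ[ℂ] D) (ψ : B →⋆ₙₐ[ℂ] D) :
    FreeProduct A B →⋆ₙₐ[ℂ] D :=
  UniversalPair.lift (R := noRelation A B) φ ψ trivial

theorem lift_inl {D : Type u} [NonUnitalCStarAlgebra D] (φ : A →⋆ₙₐ[ℂ] D) (ψ : B →⋆ₙₐ[ℂ] D)
    (a : A) : lift φ ψ (inl A B a) = φ a :=
  UniversalPair.lift_inl (R := noRelation A B) φ ψ trivial a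

theorem lift_inr {D : Type u} [NonUnitalCStarAlgebra D] (φ : A →⋆ₙₐ[ℂ] D) (ψ : B →⋆ₙₐ[ℂ] D)
    (b : B) : lift φ ψ (inr A B b) = ψ b :=
  UniversalPair.lift_inr (R := noRelation A B) φ ψ trivial b

theorem hom_ext {D : Type u} [NonUnitalCStarAlgebra D] {f g : FreeProduct A B →⋆ₙₐ[ℂ] D}
    (hl : ∀ a, f (inl A B a) = g (inl A B a)) (hr : ∀ b, f (inr A B b) = g (inr A B b)) : f = g :=
  UniversalPair.hom_ext (R := noRelation A B) (NonUnitalStarAlgHom.ext hl)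
    (NonUnitalStarAlgHom.ext hr)

end FreeProduct

namespace UnitalFreeProduct

/-- The canonical unital *-homomorphism `A → A *_ℂ B`. -/
def inl : A →⋆ₐ[ℂ] UnitalFreeProduct A B where
  __ := UniversalPair.inl (commonUnit A B)
  map_one' := rfl
  commutes' r := by
    rw [Algebra.algebraMap_eq_smul_one, Algebra.algebraMap_eq_smul_one]
    exact map_smul (UniversalPair.inl (commonUnit A B)) r 1

/-- The canonical unital *-homomorphism `B → A *_ℂ B`. -/
def inr : B →⋆ₐ[ℂ] UnitalFreeProduct A B where
  __ := UniversalPair.inr (commonUnit A B)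
  map_one' := (commonUnit_inl_inr A B).symm
  commutes' r := by
    rw [Algebra.algebraMap_eq_smul_one, Algebra.algebraMap_eq_smul_one]
    refine (map_smul (UniversalPair.inr (commonUnit A B)) r 1).trans ?_
    rw [← commonUnit_inl_inr]
    rfl

variable {A B}

/-- The unital homomorphism on `A *_ℂ B` determined by its restrictions to `A` and `B`. -/
def lift {D : Type u} [CStarAlgebra D] (φ : A →⋆ₐ[ℂ] D) (ψ : B →⋆ₐ[ℂ] D) :
    UnitalFreeProduct A B →⋆ₐ[ℂ] D :=
  letI f := UniversalPair.lift (R := commonUnit A B) φ.toNonUnitalStarAlgHom ψ.toNonUnitalStarAlgHom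
    ((map_one φ).trans (map_one ψ).symm)
  haveI h1 : f (UniversalPair.inl (commonUnit A B) 1) = 1 :=
    (UniversalPair.lift_inl _ _ _ _).trans (map_one φ)
  { f with
    map_one' := h1
    commutes' := fun r => by
      rw [Algebra.algebraMap_eq_smul_one, Algebra.algebraMap_eq_smul_one]
      refine (map_smul f r (UniversalPair.inl (commonUnit A B) 1)).trans ?_
      rw [h1] }

theorem lift_inl {D : Type u} [CStarAlgebra D] (φ : A →⋆ₐ[ℂ] D) (ψ : B →⋆ₐ[ℂ] D) (a : A) :
    lift φ ψ (inl A B a) = φ a :=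
  UniversalPair.lift_inl (R := commonUnit A B) φ.toNonUnitalStarAlgHom ψ.toNonUnitalStarAlgHom
    ((map_one φ).trans (map_one ψ).symm) a

theorem lift_inr {D : Type u} [CStarAlgebra D] (φ : A →⋆ₐ[ℂ] D) (ψ : B →⋆ₐ[ℂ] D) (b : B) :
    lift φ ψ (inr A B b) = ψ b :=
  UniversalPair.lift_inr (R := commonUnit A B) φ.toNonUnitalStarAlgHom ψ.toNonUnitalStarAlgHom
    ((map_one φ).trans (map_one ψ).symm) b

theorem hom_ext {D : Type u} [CStarAlgebra D] {f g : UnitalFreeProduct A B →⋆ₐ[ℂ] D}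
    (hl : ∀ a, f (inl A B a) = g (inl A B a)) (hr : ∀ b, f (inr A B b) = g (inr A B b)) :
    f = g := by
  have h := UniversalPair.hom_ext (R := commonUnit A B) (f := f.toNonUnitalStarAlgHom)
    (g := g.toNonUnitalStarAlgHom) (NonUnitalStarAlgHom.ext hl) (NonUnitalStarAlgHom.ext hr)
  ext x
  exact DFunLike.congr_fun h x

end UnitalFreeProduct

namespace MaxTensorProduct

/-- The canonical unital *-homomorphism `A → A ⊗ B`, `a ↦ a ⊗ 1`. -/
def inl : A →⋆ₐ[ℂ] MaxTensorProduct A B where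
  __ := UniversalPair.inl (commuteCommonUnit A B)
  map_one' := rfl
  commutes' r := by
    rw [Algebra.algebraMap_eq_smul_one, Algebra.algebraMap_eq_smul_one]
    exact map_smul (UniversalPair.inl (commuteCommonUnit A B)) r 1

/-- The canonical unital *-homomorphism `B → A ⊗ B`, `b ↦ 1 ⊗ b`. -/
def inr : B →⋆ₐ[ℂ] MaxTensorProduct A B where
  __ := UniversalPair.inr (commuteCommonUnit A B)
  map_one' := (commuteCommonUnit_inl_inr A B).symm
  commutes' r := by
    rw [Algebra.algebraMap_eq_smul_one, Algebra.algebraMap_eq_smul_one]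
    refine (map_smul (UniversalPair.inr (commuteCommonUnit A B)) r 1).trans ?_
    rw [← commuteCommonUnit_inl_inr]
    rfl

theorem inl_mul_inr (a : A) (b : B) : inl A B a * inr A B b = inr A B b * inl A B a :=
  UniversalPair.coord_ext (R := commuteCommonUnit A B) fun p => by
    refine (map_mul (UniversalPair.coord _ p) (UniversalPair.inl _ a)
      (UniversalPair.inr _ b)).trans (.trans ?_ (map_mul (UniversalPair.coord _ p)
      (UniversalPair.inr _ b) (UniversalPair.inl _ a)).symm)
    exact p.rel.2 a b

variable {A B}

/-- The unital homomorphism on `A ⊗ B` determined by its (commuting) restrictions to `A` and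
`B`. -/
def lift {D : Type u} [CStarAlgebra D] (φ : A →⋆ₐ[ℂ] D) (ψ : B →⋆ₐ[ℂ] D)
    (h : ∀ a b, φ a * ψ b = ψ b * φ a) : MaxTensorProduct A B →⋆ₐ[ℂ] D :=
  letI f := UniversalPair.lift (R := commuteCommonUnit A B) φ.toNonUnitalStarAlgHom ψ.toNonUnitalStarAlgHom
    ⟨(map_one φ).trans (map_one ψ).symm, h⟩
  haveI h1 : f (UniversalPair.inl (commuteCommonUnit A B) 1) = 1 :=
    (UniversalPair.lift_inl _ _ _ _).trans (map_one φ)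
  { f with
    map_one' := h1
    commutes' := fun r => by
      rw [Algebra.algebraMap_eq_smul_one, Algebra.algebraMap_eq_smul_one]
      refine (map_smul f r (UniversalPair.inl (commuteCommonUnit A B) 1)).trans ?_
      rw [h1] }

theorem lift_inl {D : Type u} [CStarAlgebra D] (φ : A →⋆ₐ[ℂ] D) (ψ : B →⋆ₐ[ℂ] D)
    (h : ∀ a b, φ a * ψ b = ψ b * φ a) (a : A) : lift φ ψ h (inl A B a) = φ a :=
  UniversalPair.lift_inl (R := commuteCommonUnit A B) φ.toNonUnitalStarAlgHom ψ.toNonUnitalStarAlgHom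
    ⟨(map_one φ).trans (map_one ψ).symm, h⟩ a

theorem lift_inr {D : Type u} [CStarAlgebra D] (φ : A →⋆ₐ[ℂ] D) (ψ : B →⋆ₐ[ℂ] D)
    (h : ∀ a b, φ a * ψ b = ψ b * φ a) (b : B) : lift φ ψ h (inr A B b) = ψ b :=
  UniversalPair.lift_inr (R := commuteCommonUnit A B) φ.toNonUnitalStarAlgHom ψ.toNonUnitalStarAlgHom
    ⟨(map_one φ).trans (map_one ψ).symm, h⟩ b

theorem hom_ext {D : Type u} [CStarAlgebra D] {f g : MaxTensorProduct A B →⋆ₐ[ℂ] D}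
    (hl : ∀ a, f (inl A B a) = g (inl A B a)) (hr : ∀ b, f (inr A B b) = g (inr A B b)) :
    f = g := by
  have h := UniversalPair.hom_ext (R := commuteCommonUnit A B) (f := f.toNonUnitalStarAlgHom)
    (g := g.toNonUnitalStarAlgHom) (NonUnitalStarAlgHom.ext hl) (NonUnitalStarAlgHom.ext hr)
  ext x
  exact DFunLike.congr_fun h x

end MaxTensorProduct

/-- The natural quotient map `π : A * B → A ⊗ B`. -/
def FreeProduct.toTensor : FreeProduct A B →⋆ₙₐ[ℂ] MaxTensorProduct A B :=
  FreeProduct.lift (MaxTensorProduct.inl A B).toNonUnitalStarAlgHom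
    (MaxTensorProduct.inr A B).toNonUnitalStarAlgHom

/-- The natural unital quotient map `π : A *_ℂ B → A ⊗ B`. -/
def UnitalFreeProduct.toTensor : UnitalFreeProduct A B →⋆ₐ[ℂ] MaxTensorProduct A B :=
  UnitalFreeProduct.lift (MaxTensorProduct.inl A B) (MaxTensorProduct.inr A B)

end Products

/-! ## Homotopy and smooth absorption -/

/-- Two *-homomorphisms are homotopic if they are joined by a point-norm continuous path of
*-homomorphisms. -/
def StarHomotopic {A D : Type u} [NonUnitalCStarAlgebra A] [NonUnitalCStarAlgebra D]
    (φ ψ : A →⋆ₙₐ[ℂ] D) : Prop :=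
  ∃ H : unitInterval → (A →⋆ₙₐ[ℂ] D),
    (∀ a, Continuous fun t => H t a) ∧ H 0 = φ ∧ H 1 = ψ

/-- `A` absorbs `B` smoothly if some isomorphism `A → A ⊗ B` is homotopic to `a ↦ a ⊗ 1`. -/
def AbsorbsSmoothly (A B : Type u) [CStarAlgebra A] [CStarAlgebra B] : Prop :=
  ∃ φ : A ≃⋆ₐ[ℂ] MaxTensorProduct A B,
    StarHomotopic φ.toNonUnitalStarAlgHom
      (MaxTensorProduct.inl A B).toNonUnitalStarAlgHom

end

/-! The idea is homotopy lifting. If `φ : A ≃ A ⊗ B` is homotopic to `a ↦ a ⊗ 1`, the latter lifts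
through `π` (and `π₁`) by the canonical inclusion of `A`. If the lift can be transported along the
homotopy to a lift `ψ` of `φ`, then `ψ ∘ φ⁻¹` is a splitting.

Transport rests on semiprojectivity, applied to the bounded sequences in `D` and the ideals of
sequences in `ker π` that vanish from index `m` on, whose closed union is `c₀(ker π)`. If
homomorphisms `χ n` into `E` are asymptotic to `π ∘ ψ n`, the sequences that lift `χ n a` exactly
and are asymptotic to `ψ n a` form one class modulo `c₀(ker π)`, and these classes define a
homomorphism on `A`. Lifting it modulo one of the ideals and reading off late coordinates gives
exact lifts of `χ n` that stay close to `ψ n` (`eventually_exists_lift`). Arguing by contradiction,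
this yields a step size along the homotopy that works at all times and for all lifts
(`exists_uniform_lift`), so the set of liftable times is clopen in `[0,1]`
(`exists_lift_of_starHomotopic`).

For the unital statement, each step moves the image of `1` by less than `1`, and an idempotent that
close to `1` equals `1`; hence unitality survives every step. -/

open Filter Topology

/-! ### Bounded lifts through homomorphisms with dense range -/

namespace NonUnitalStarAlgHom

section DenseRange

variable {D E : Type*} [NonUnitalCStarAlgebra D] [NonUnitalCStarAlgebra E]

/-- The image of a selfadjoint element under a *-homomorphism lifts to an element of at most the
same norm. -/
theorem exists_norm_le_of_isSelfAdjoint (π : D →⋆ₙₐ[ℂ] E) (hπ : Continuous π) {x : D}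
    (hx : IsSelfAdjoint x) : ∃ y, π y = π x ∧ ‖y‖ ≤ ‖π x‖ := by
  have hπx : IsSelfAdjoint (π x) := hx.map π
  set c := ‖π x‖ with hc_def
  have hc : 0 ≤ c := norm_nonneg _
  -- Truncation to `[-c, c]`: it is the identity on the spectrum of `π x`, so applying it to `x`
  -- cuts the norm down to `c` without changing the image.
  let g : ℝ → ℝ := fun t => max (-c) (min t c)
  have hg : Continuous g := by fun_prop
  have hg0 : g 0 = 0 := by simp [g, hc]
  refine ⟨cfcₙ g x, ?_, ?_⟩
  · rw [π.map_cfcₙ g x hg.continuousOn hg0 hπ hx hπx]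
    conv_rhs => rw [← cfcₙ_id' ℝ (π x) hπx]
    refine cfcₙ_congr fun t ht => ?_
    have h := norm_apply_le_norm_cfcₙ (fun t : ℝ => t) (π x) ht
    rw [cfcₙ_id' ℝ (π x) hπx, Real.norm_eq_abs, ← hc_def] at h
    obtain ⟨h1, h2⟩ := abs_le.1 h
    simp [g, h1, h2]
  · refine norm_cfcₙ_le fun t _ => ?_
    rw [Real.norm_eq_abs, abs_le]
    exact ⟨le_max_left _ _, max_le (by linarith) (min_le_right _ _)⟩

/-- A *-homomorphism between C*-algebras with dense range is surjective, with bounded lifts. -/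
theorem exists_norm_le_of_denseRange (π : D →⋆ₙₐ[ℂ] E) (hd : DenseRange π) (e : E) :
    ∃ d, π d = e ∧ ‖d‖ ≤ 3 * ‖e‖ := by
  let f : NormedAddGroupHom D E := (π : D →+ E).mkNormedAddGroupHom 1 fun x => by
    simpa using NonUnitalStarAlgHom.norm_apply_le π x
  have hπ : Continuous π := f.continuous
  -- Real and imaginary parts lift separately without increase of norm, which costs a factor `2` on
  -- the range.
  have h2 : f.SurjectiveOnWith f.range 2 := by
    rintro _ ⟨x, rfl⟩
    change ∃ g, π g = π x ∧ ‖g‖ ≤ 2 * ‖π x‖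
    obtain ⟨y, hy, hyn⟩ := exists_norm_le_of_isSelfAdjoint π hπ (realPart x).2
    obtain ⟨z, hz, hzn⟩ := exists_norm_le_of_isSelfAdjoint π hπ (imaginaryPart x).2
    rw [map_realPart] at hyn
    rw [map_imaginaryPart] at hzn
    refine ⟨y + Complex.I • z, ?_, ?_⟩
    · rw [map_add, map_smul, hy, hz, ← map_smul, ← map_add, realPart_add_I_smul_imaginaryPart]
    · calc ‖y + Complex.I • z‖ ≤ ‖y‖ + ‖z‖ := by
            simpa [norm_smul] using norm_add_le y (Complex.I • z)
        _ ≤ ‖π x‖ + ‖π x‖ :=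
            add_le_add (hyn.trans (realPart.norm_le (π x))) (hzn.trans (imaginaryPart.norm_le (π x)))
        _ = 2 * ‖π x‖ := by ring
  -- Successive approximation extends the lifting from the range to its closure, here all of `E`, at
  -- an extra cost of `1`; hence `3 = 2 + 1`.
  obtain ⟨d, hd, hdn⟩ := controlled_closure_of_complete two_pos one_pos h2 e (hd e)
  exact ⟨d, hd, hdn.trans_eq (by norm_num)⟩

end DenseRange

end NonUnitalStarAlgHom

/-! ### Density in universal algebras and maps out of quotients -/

namespace UniversalPair

variable {A B : Type u} [NonUnitalCStarAlgebra A] [NonUnitalCStarAlgebra B]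

/-- A *-homomorphism into a universal C*-algebra whose range contains the generators has dense
range. -/
theorem denseRange_of_comp_eq {R : PairRelation A B} {D : Type u} [NonUnitalCStarAlgebra D]
    (π : D →⋆ₙₐ[ℂ] UniversalPair R) (φ : A →⋆ₙₐ[ℂ] D) (ψ : B →⋆ₙₐ[ℂ] D)
    (hφ : π.comp φ = inl R) (hψ : π.comp ψ = inr R) : DenseRange π := fun x =>
  closed_induction (P := fun x => x ∈ closure (Set.range π)) isClosed_closure
    (fun t => subset_closure ⟨PairTerm.eval φ ψ t, by rw [PairTerm.map_eval, hφ, hψ]⟩) x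

end UniversalPair

namespace ClosedIdeal

/-- The *-homomorphism on `D / J` induced by a *-homomorphism on `D` vanishing on `J`. -/
def Quot.lift {D E : Type u} [NonUnitalCStarAlgebra D] [NonUnitalCStarAlgebra E]
    (J : ClosedIdeal D) (f : D →⋆ₙₐ[ℂ] E) (hf : ∀ x ∈ J.toSubmodule, f x = 0) :
    J.Quot →⋆ₙₐ[ℂ] E where
  toFun := Submodule.liftQ J.toSubmodule (f : D →ₗ[ℂ] E) hf
  map_smul' r x := map_smul (Submodule.liftQ J.toSubmodule (f : D →ₗ[ℂ] E) hf) r x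
  map_zero' := map_zero (Submodule.liftQ J.toSubmodule (f : D →ₗ[ℂ] E) hf)
  map_add' x y := map_add (Submodule.liftQ J.toSubmodule (f : D →ₗ[ℂ] E) hf) x y
  map_mul' x y := by
    obtain ⟨x, rfl⟩ := Quot.of_surjective J x
    obtain ⟨y, rfl⟩ := Quot.of_surjective J y
    exact map_mul f x y
  map_star' x := by
    obtain ⟨x, rfl⟩ := Quot.of_surjective J x
    exact map_star f x

theorem Quot.lift_proj {D E : Type u} [NonUnitalCStarAlgebra D] [NonUnitalCStarAlgebra E]
    (J : ClosedIdeal D) (f : D →⋆ₙₐ[ℂ] E) (hf : ∀ x ∈ J.toSubmodule, f x = 0) (d : D) :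
    Quot.lift J f hf (J.proj d) = f d := rfl

end ClosedIdeal

/-! ### Bounded sequences and the ideals approximating `c₀(ker π)` -/

section SequenceAlgebra

variable {D E : Type u} [NonUnitalCStarAlgebra D] [NonUnitalCStarAlgebra E]

/-- The coordinate homomorphisms of the algebra of bounded sequences. -/
def seqEval (D : Type u) [NonUnitalCStarAlgebra D] (n : ℕ) :
    lp (fun _ : ℕ => D) ∞ →⋆ₙₐ[ℂ] D where
  toFun x := x n
  map_smul' _ _ := rfl
  map_zero' := rfl
  map_add' _ _ := rfl
  map_mul' _ _ := rfl
  map_star' _ := rfl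

theorem seqEval_apply (n : ℕ) (x : lp (fun _ : ℕ => D) ∞) : seqEval D n x = x n := rfl

/-- The ideal of sequences in the kernel of `π` which vanish from the index `m` on. -/
def kerSeqIdeal (π : D →⋆ₙₐ[ℂ] E) (m : ℕ) : ClosedIdeal (lp (fun _ : ℕ => D) ∞) where
  -- The kernel condition makes every `π (x n)` depend only on the class of `x`; the vanishing
  -- condition does the same for `x n` itself once `m ≤ n`.
  carrier := {x | ∀ n, π (seqEval D n x) = 0 ∧ (m ≤ n → seqEval D n x = 0)}
  add_mem' hx hy n := by
    simp only [map_add, (hx n).1, (hy n).1, add_zero, true_and]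
    intro h
    rw [(hx n).2 h, (hy n).2 h, add_zero]
  zero_mem' n := by simp only [map_zero, implies_true, and_self]
  smul_mem' r x hx n := by
    simp only [map_smul, (hx n).1, smul_zero, true_and]
    intro h
    rw [(hx n).2 h, smul_zero]
  mul_mem_left' d x hx n := by
    simp only [map_mul, (hx n).1, mul_zero, true_and]
    intro h
    rw [(hx n).2 h, mul_zero]
  mul_mem_right' d x hx n := by
    simp only [map_mul, (hx n).1, zero_mul, true_and]
    intro h
    rw [(hx n).2 h, zero_mul]
  isClosed' := by
    have h1 : ∀ n, Continuous (seqEval D n) := fun n =>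
      NonUnitalStarAlgHom.continuous_of_cstar (seqEval D n)
    have h2 : Continuous π := NonUnitalStarAlgHom.continuous_of_cstar π
    simp only [Set.ofPred_forall, Set.ofPred_and]
    refine isClosed_iInter fun n => (isClosed_eq (h2.comp (h1 n)) continuous_const).inter ?_
    exact isClosed_iInter fun _ => isClosed_eq (h1 n) continuous_const

theorem mem_kerSeqIdeal {π : D →⋆ₙₐ[ℂ] E} {m : ℕ} {x : lp (fun _ : ℕ => D) ∞} :
    x ∈ (kerSeqIdeal π m).toSubmodule ↔ ∀ n, π (x n) = 0 ∧ (m ≤ n → x n = 0) := Iff.rfl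

theorem kerSeqIdeal_mono (π : D →⋆ₙₐ[ℂ] E) (m n : ℕ) (h : m ≤ n) :
    kerSeqIdeal π m ≤ kerSeqIdeal π n :=
  fun _ hx k => ⟨(hx k).1, fun hk => (hx k).2 (h.trans hk)⟩

theorem norm_seq_apply_le (x : lp (fun _ : ℕ => D) ∞) (n : ℕ) : ‖x n‖ ≤ ‖x‖ :=
  lp.norm_apply_le_norm ENNReal.top_ne_zero x n

/-- The closed union of the ideals `kerSeqIdeal π m` consists of the null sequences in the kernel of
`π`. -/
theorem mem_closureUnion_kerSeqIdeal {π : D →⋆ₙₐ[ℂ] E} {x : lp (fun _ : ℕ => D) ∞} :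
    x ∈ (ClosedIdeal.closureUnion (kerSeqIdeal π) (kerSeqIdeal_mono π)).toSubmodule ↔
      (∀ n, π (x n) = 0) ∧ Tendsto (fun n => x n) atTop (𝓝 0) := by
  rw [← SetLike.mem_coe, ClosedIdeal.coe_closureUnion]
  constructor
  · intro hx
    refine ⟨fun n => ?_, ?_⟩
    · refine closure_minimal (t := {x : lp (fun _ : ℕ => D) ∞ | π (seqEval D n x) = 0}) ?_
        (isClosed_eq ((NonUnitalStarAlgHom.continuous_of_cstar π).comp
          (NonUnitalStarAlgHom.continuous_of_cstar (seqEval D n))) continuous_const) hx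
      exact Set.iUnion_subset fun m y hy => (hy n).1
    · rw [Metric.tendsto_atTop]
      intro ε hε
      obtain ⟨y, hy, hxy⟩ := Metric.mem_closure_iff.1 hx ε hε
      obtain ⟨m, hm⟩ := Set.mem_iUnion.1 hy
      refine ⟨m, fun n hn => ?_⟩
      have h1 : y n = 0 := (hm n).2 hn
      have h2 := norm_seq_apply_le (x - y) n
      rw [dist_zero_right]
      rw [dist_eq_norm] at hxy
      have h3 : (x - y) n = x n := by
        change x n - y n = x n
        rw [h1, sub_zero]
      rw [h3] at h2
      exact h2.trans_lt hxy
  · rintro ⟨h1, h2⟩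
    rw [Metric.mem_closure_iff]
    intro ε hε
    -- Coordinatewise bounds only give a weak inequality for the supremum norm, so `ε / 2` is used
    -- to end strictly below `ε`.
    obtain ⟨m, hm⟩ := Metric.tendsto_atTop.1 h2 (ε / 2) (half_pos hε)
    let y : lp (fun _ : ℕ => D) ∞ := ⟨fun n => if n < m then x n else 0,
      memℓp_infty ⟨‖x‖, by
        rintro _ ⟨n, rfl⟩
        dsimp only
        split_ifs
        · exact norm_seq_apply_le x n
        · rw [norm_zero]; exact norm_nonneg _⟩⟩
    have hy : ∀ n, y n = if n < m then x n else 0 := fun _ => rfl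
    refine ⟨y, Set.mem_iUnion.2 ⟨m, mem_kerSeqIdeal.2 fun n => ⟨?_, fun hn => ?_⟩⟩, ?_⟩
    · rw [hy]
      split_ifs
      · exact h1 n
      · exact map_zero π
    · rw [hy, if_neg hn.not_gt]
    · rw [dist_eq_norm]
      refine (lp.norm_le_of_forall_le (half_pos hε).le fun n => ?_).trans_lt (half_lt_self hε)
      change ‖x n - y n‖ ≤ ε / 2
      rw [hy]
      split_ifs with h
      · rw [sub_self, norm_zero]; exact (half_pos hε).le
      · rw [sub_zero, ← dist_zero_right]; exact (hm n (not_lt.1 h)).le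

end SequenceAlgebra

/-! ### Lifting and homotopy for semiprojective domains -/

namespace IsSemiprojective

variable {A D E : Type u} [NonUnitalCStarAlgebra A] [NonUnitalCStarAlgebra D]
  [NonUnitalCStarAlgebra E]

/-- Homomorphisms from a semiprojective C*-algebra which are asymptotically close to homomorphisms
that lift through `π` eventually lift as well, with lifts asymptotically close to the given ones. -/
theorem eventually_exists_lift (hA : IsSemiprojective A) (π : D →⋆ₙₐ[ℂ] E) (hπ : DenseRange π)
    (ψ : ℕ → A →⋆ₙₐ[ℂ] D) (χ : ℕ → A →⋆ₙₐ[ℂ] E)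
    (h : ∀ a, Tendsto (fun n => χ n a - π (ψ n a)) atTop (𝓝 0)) (a₀ : A) {ε : ℝ} (hε : 0 < ε) :
    ∀ᶠ n in atTop, ∃ ψ' : A →⋆ₙₐ[ℂ] D, π.comp ψ' = χ n ∧ ‖ψ' a₀ - ψ n a₀‖ < ε := by
  let P := lp (fun _ : ℕ => D) ∞
  let J := kerSeqIdeal π
  have hJ := kerSeqIdeal_mono π
  let K := ClosedIdeal.closureUnion J hJ
  let Good : A → P → Prop := fun a x =>
    (∀ n, π (x n) = χ n a) ∧ Tendsto (fun n => x n - ψ n a) atTop (𝓝 0)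
  -- Correct `ψ n a` by a lift of the error `χ n a - π (ψ n a)`; the norm bound on lifts makes the
  -- corrections bounded and null.
  have hex : ∀ a, ∃ x, Good a x := by
    intro a
    choose d hd hdn using fun n =>
      NonUnitalStarAlgHom.exists_norm_le_of_denseRange π hπ (χ n a - π (ψ n a))
    refine ⟨⟨fun n => ψ n a + d n, memℓp_infty ⟨‖a‖ + 3 * (‖a‖ + ‖a‖), ?_⟩⟩, fun n => ?_, ?_⟩
    · rintro _ ⟨n, rfl⟩
      have h1 : ‖ψ n a‖ ≤ ‖a‖ := NonUnitalStarAlgHom.norm_apply_le _ _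
      have h2 : ‖χ n a‖ ≤ ‖a‖ := NonUnitalStarAlgHom.norm_apply_le _ _
      have h3 : ‖π (ψ n a)‖ ≤ ‖a‖ := (NonUnitalStarAlgHom.norm_apply_le _ _).trans h1
      have h4 := norm_sub_le (χ n a) (π (ψ n a))
      have h5 := norm_add_le (ψ n a) (d n)
      have h6 := hdn n
      dsimp only
      linarith
    · change π (ψ n a + d n) = χ n a
      rw [map_add, hd, add_sub_cancel]
    · change Tendsto (fun n => ψ n a + d n - ψ n a) atTop (𝓝 0)
      simp only [add_sub_cancel_left]
      refine squeeze_zero_norm hdn ?_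
      simpa using (h a).norm.const_mul 3
  -- Two candidates differ by a null sequence in `ker π`, that is, by an element of `K`. The class
  -- is therefore independent of choices, and `φ` below is a homomorphism as soon as `Good` respects
  -- the operations.
  have huniq : ∀ a x y, Good a x → Good a y → K.proj x = K.proj y := by
    intro a x y hx hy
    rw [ClosedIdeal.proj_eq_proj]
    refine mem_closureUnion_kerSeqIdeal.2 ⟨fun n => ?_, ?_⟩
    · change π (x n - y n) = 0
      rw [map_sub, hx.1, hy.1, sub_self]
    · change Tendsto (fun n => x n - y n) atTop (𝓝 0)
      simpa using hx.2.sub hy.2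
  choose g hg using hex
  have hval : ∀ {a x}, Good a x → K.proj (g a) = K.proj x := fun hx => huniq _ _ _ (hg _) hx
  let φ : A →⋆ₙₐ[ℂ] K.Quot :=
    { toFun := fun a => K.proj (g a)
      map_smul' := fun r a => by
        refine (hval (x := r • g a) ⟨fun n => ?_, ?_⟩).trans (map_smul K.proj r (g a))
        · change π (r • g a n) = _
          rw [map_smul, map_smul, (hg a).1]
        · change Tendsto (fun n => r • g a n - ψ n (r • a)) atTop (𝓝 0)
          simpa [smul_sub] using (hg a).2.const_smul r
      map_zero' := by
        refine (hval (x := 0) ⟨fun n => ?_, ?_⟩).trans (map_zero K.proj)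
        · change π 0 = _
          rw [map_zero, map_zero]
        · change Tendsto (fun n => (0 : D) - ψ n 0) atTop (𝓝 0)
          simp
      map_add' := fun a b => by
        refine (hval (x := g a + g b) ⟨fun n => ?_, ?_⟩).trans (map_add K.proj _ _)
        · change π (g a n + g b n) = _
          rw [map_add, map_add, (hg a).1, (hg b).1]
        · change Tendsto (fun n => g a n + g b n - ψ n (a + b)) atTop (𝓝 0)
          simpa [add_sub_add_comm] using (hg a).2.add (hg b).2
      map_mul' := fun a b => by
        refine (hval (x := g a * g b) ⟨fun n => ?_, ?_⟩).trans (map_mul K.proj _ _)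
        · change π (g a n * g b n) = _
          rw [map_mul, map_mul, (hg a).1, (hg b).1]
        · change Tendsto (fun n => g a n * g b n - ψ n (a * b)) atTop (𝓝 0)
          -- Split `xy - x'y' = (x - x')y + x'(y - y')`, with `y` bounded by its supremum norm and
          -- `x'` by contractivity of `ψ n`.
          have h1 : Tendsto (fun n => (g a n - ψ n a) * g b n) atTop (𝓝 0) := by
            refine squeeze_zero_norm (a := fun n => ‖g a n - ψ n a‖ * ‖g b‖) (fun n => ?_) ?_
            · exact (norm_mul_le _ _).trans
                (mul_le_mul_of_nonneg_left (norm_seq_apply_le _ _) (norm_nonneg _))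
            · simpa using (hg a).2.norm.mul_const ‖g b‖
          have h2 : Tendsto (fun n => ψ n a * (g b n - ψ n b)) atTop (𝓝 0) := by
            refine squeeze_zero_norm (a := fun n => ‖a‖ * ‖g b n - ψ n b‖) (fun n => ?_) ?_
            · exact (norm_mul_le _ _).trans (mul_le_mul_of_nonneg_right
                (NonUnitalStarAlgHom.norm_apply_le _ _) (norm_nonneg _))
            · simpa using (hg b).2.norm.const_mul ‖a‖
          have h3 := h1.add h2
          rw [add_zero] at h3
          refine h3.congr fun n => ?_
          rw [map_mul]
          noncomm_ring
      map_star' := fun a => by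
        refine (hval (x := star (g a)) ⟨fun n => ?_, ?_⟩).trans (map_star K.proj _)
        · change π (star (g a n)) = _
          rw [map_star, map_star, (hg a).1]
        · change Tendsto (fun n => star (g a n) - ψ n (star a)) atTop (𝓝 0)
          simpa [map_star] using (hg a).2.star }
  obtain ⟨m, Ψ, hΨ⟩ := hA.2 P J hJ φ
  have hrep : ∀ a, ∃ x : P, (J m).proj x = Ψ a ∧ Good a x := by
    intro a
    obtain ⟨x, hx⟩ := ClosedIdeal.proj_surjective (J m) (Ψ a)
    -- A representative of `Ψ a` modulo `J m` differs from `g a` by an element of `K`, and such a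
    -- perturbation preserves `Good`.
    have h1 : K.proj x = K.proj (g a) := by
      have := DFunLike.congr_fun hΨ a
      rw [NonUnitalStarAlgHom.comp_apply, ← hx, ClosedIdeal.factor_proj] at this
      exact this
    obtain ⟨h2, h3⟩ := mem_closureUnion_kerSeqIdeal.1 ((ClosedIdeal.proj_eq_proj K).1 h1)
    refine ⟨x, hx, fun n => ?_, ?_⟩
    · have h4 : π (x n - g a n) = 0 := h2 n
      rw [← (hg a).1, ← sub_eq_zero, ← map_sub, h4]
    · have h4 := h3.add (hg a).2
      rw [add_zero] at h4
      refine h4.congr fun n => ?_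
      change x n - g a n + (g a n - ψ n a) = _
      exact sub_add_sub_cancel _ _ _
  choose x hx hgood using hrep
  have hsmall : ∀ᶠ n in atTop, ‖x a₀ n - ψ n a₀‖ < ε := by
    have := (hgood a₀).2.norm
    rw [norm_zero] at this
    exact this.eventually_lt_const hε
  filter_upwards [hsmall, eventually_ge_atTop m] with n hn hmn
  -- From index `m` on, evaluation kills `J m` and so descends to the quotient; composed with `Ψ` it
  -- is an honest homomorphism into `D`.
  let ev := ClosedIdeal.Quot.lift (J m) (seqEval D n) fun y hy => (hy n).2 hmn
  have hev : ∀ a, ev (Ψ a) = x a n := fun a => by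
    rw [← hx, ClosedIdeal.Quot.lift_proj, seqEval_apply]
  refine ⟨ev.comp Ψ, ?_, ?_⟩
  · ext a
    rw [NonUnitalStarAlgHom.comp_apply, NonUnitalStarAlgHom.comp_apply, hev, (hgood a).1]
  · rwa [NonUnitalStarAlgHom.comp_apply, hev]

/-- Along a homotopy, lifts of homomorphisms from a semiprojective C*-algebra can be transported by
uniform steps, with small changes at a given element. -/
theorem exists_uniform_lift (hA : IsSemiprojective A) (π : D →⋆ₙₐ[ℂ] E) (hπ : DenseRange π)
    (H : unitInterval → (A →⋆ₙₐ[ℂ] E)) (hH : ∀ a, Continuous fun t => H t a) (a₀ : A) {ε : ℝ}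
    (hε : 0 < ε) : ∃ δ > 0, ∀ s t, dist s t < δ → ∀ ψ : A →⋆ₙₐ[ℂ] D, π.comp ψ = H s →
      ∃ ψ' : A →⋆ₙₐ[ℂ] D, π.comp ψ' = H t ∧ ‖ψ' a₀ - ψ a₀‖ < ε := by
  -- Failure for every `δ = 1 / (n + 1)` produces times and lifts `ψ n` at once, so the resulting
  -- `δ` is uniform over lifts as well as over times.
  by_contra! hcon
  choose s t hst ψ hψ hcon using fun n : ℕ => hcon (1 / ((n : ℝ) + 1)) (by positivity)
  have hlim : ∀ a, Tendsto (fun n => H (t n) a - π (ψ n a)) atTop (𝓝 0) := by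
    intro a
    -- Compactness of `[0,1]` turns `dist (s n) (t n) → 0` into `H (t n) a - H (s n) a → 0`,
    -- although neither sequence need converge.
    have huc : UniformContinuous fun t => H t a :=
      CompactSpace.uniformContinuous_of_continuous (hH a)
    rw [Metric.tendsto_atTop]
    intro η hη
    obtain ⟨δ, hδ, hu⟩ := Metric.uniformContinuous_iff.1 huc η hη
    obtain ⟨N, hN⟩ := exists_nat_one_div_lt hδ
    refine ⟨N, fun n hn => ?_⟩
    have h1 : π (ψ n a) = H (s n) a := DFunLike.congr_fun (hψ n) a
    rw [h1, dist_zero_right, ← dist_eq_norm, dist_comm]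
    exact hu ((hst n).trans_le ((Nat.one_div_le_one_div hn).trans hN.le))
  obtain ⟨n, ψ', h1, h2⟩ :=
    (eventually_exists_lift hA π hπ ψ (fun n => H (t n)) hlim a₀ hε).exists
  exact (hcon n ψ' h1).not_gt h2

/-- Homotopy lifting: if a homomorphism from a semiprojective C*-algebra lifts through `π`, so does
every homomorphism homotopic to it. Properties of the value at a given element that are stable under
small changes are preserved. -/
theorem exists_lift_of_starHomotopic (hA : IsSemiprojective A) (π : D →⋆ₙₐ[ℂ] E)
    (hπ : DenseRange π) {φ χ : A →⋆ₙₐ[ℂ] E} (hφχ : StarHomotopic φ χ) (a₀ : A) {ε : ℝ} (hε : 0 < ε)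
    (p : (A →⋆ₙₐ[ℂ] D) → Prop) (hp : ∀ ψ ψ', p ψ → ‖ψ' a₀ - ψ a₀‖ < ε → p ψ')
    (ψ : A →⋆ₙₐ[ℂ] D) (hψ : π.comp ψ = χ) (hpψ : p ψ) :
    ∃ ψ' : A →⋆ₙₐ[ℂ] D, π.comp ψ' = φ ∧ p ψ' := by
  obtain ⟨H, hH, rfl, rfl⟩ := hφχ
  obtain ⟨δ, hδ, hstep⟩ := exists_uniform_lift hA π hπ H hH a₀ hε
  let S : Set unitInterval := {t | ∃ ψ' : A →⋆ₙₐ[ℂ] D, π.comp ψ' = H t ∧ p ψ'}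
  -- Displacements at `a₀` may add up over many steps, so `p` has to be recovered after each one. As
  -- `δ` does not depend on `s`, this gives closedness as well as openness of `S`.
  have hS : ∀ s ∈ S, ∀ t, dist s t < δ → t ∈ S := by
    rintro s ⟨ψ', h1, h2⟩ t hst
    obtain ⟨ψ'', h3, h4⟩ := hstep s t hst ψ' h1
    exact ⟨ψ'', h3, hp _ _ h2 h4⟩
  have hclopen : IsClopen S := by
    refine ⟨isClosed_of_closure_subset fun t ht => ?_, Metric.isOpen_iff.2 fun s hs => ?_⟩
    · obtain ⟨s, hs, hst⟩ := Metric.mem_closure_iff.1 ht δ hδ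
      exact hS s hs t (by rwa [dist_comm])
    · exact ⟨δ, hδ, fun t ht => hS s hs t (by rwa [dist_comm])⟩
  have : S = Set.univ := hclopen.eq_univ ⟨1, ψ, hψ, hpψ⟩
  exact this.ge (Set.mem_univ 0)

end IsSemiprojective

/-! ### Units and the two splittings -/

/-- The complement `1 - e` is idempotent, so `‖1 - e‖ ≤ ‖1 - e‖²`, which leaves only norm `0` or
norm at least `1`. -/
theorem IsIdempotentElem.eq_one_of_norm_sub_one_lt {R : Type*} [NormedRing R] {e : R}
    (he : IsIdempotentElem e) (h : ‖e - 1‖ < 1) : e = 1 := by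
  have hq : ‖1 - e‖ ≤ ‖1 - e‖ * ‖1 - e‖ := by
    conv_lhs => rw [← he.one_sub.eq]
    exact norm_mul_le _ _
  rw [norm_sub_rev] at h
  have h0 : ‖1 - e‖ = 0 := by nlinarith [norm_nonneg (1 - e)]
  exact (sub_eq_zero.1 (norm_eq_zero.1 h0)).symm

/-- A *-homomorphism preserving the unit, as a unital *-homomorphism. -/
def NonUnitalStarAlgHom.toStarAlgHom {A B : Type*} [CStarAlgebra A] [CStarAlgebra B]
    (f : A →⋆ₙₐ[ℂ] B) (h : f 1 = 1) : A →⋆ₐ[ℂ] B where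
  __ := f
  map_one' := h
  commutes' r := by
    rw [Algebra.algebraMap_eq_smul_one, Algebra.algebraMap_eq_smul_one]
    exact (map_smul f r 1).trans (by rw [h])

/-- The canonical copies of `A` and `B` are sent onto the generators of `A ⊗ B`. -/
theorem FreeProduct.denseRange_toTensor (A B : Type u) [CStarAlgebra A] [CStarAlgebra B] :
    DenseRange (FreeProduct.toTensor A B) :=
  UniversalPair.denseRange_of_comp_eq (R := commuteCommonUnit A B) (FreeProduct.toTensor A B)
    (FreeProduct.inl A B) (FreeProduct.inr A B)
    (NonUnitalStarAlgHom.ext fun a => FreeProduct.lift_inl _ _ a)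
    (NonUnitalStarAlgHom.ext fun b => FreeProduct.lift_inr _ _ b)

theorem UnitalFreeProduct.denseRange_toTensor (A B : Type u) [CStarAlgebra A] [CStarAlgebra B] :
    DenseRange (UnitalFreeProduct.toTensor A B) :=
  UniversalPair.denseRange_of_comp_eq (R := commuteCommonUnit A B)
    (UnitalFreeProduct.toTensor A B).toNonUnitalStarAlgHom
    (UnitalFreeProduct.inl A B).toNonUnitalStarAlgHom
    (UnitalFreeProduct.inr A B).toNonUnitalStarAlgHom
    (NonUnitalStarAlgHom.ext fun a =>
      UnitalFreeProduct.lift_inl (MaxTensorProduct.inl A B) (MaxTensorProduct.inr A B) a)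
    (NonUnitalStarAlgHom.ext fun b =>
      UnitalFreeProduct.lift_inr (MaxTensorProduct.inl A B) (MaxTensorProduct.inr A B) b)

theorem mainTheorem2 (A B : Type u) [CStarAlgebra A] [CStarAlgebra B]
    [TopologicalSpace.SeparableSpace A] [TopologicalSpace.SeparableSpace B]
    (hA : IsSemiprojective A) (hAB : AbsorbsSmoothly A B) :
    (∃ σ : MaxTensorProduct A B →⋆ₙₐ[ℂ] FreeProduct A B,
      (FreeProduct.toTensor A B).comp σ = NonUnitalStarAlgHom.id ℂ (MaxTensorProduct A B)) ∧
    (∃ σ : MaxTensorProduct A B →⋆ₐ[ℂ] UnitalFreeProduct A B,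
      (UnitalFreeProduct.toTensor A B).comp σ = StarAlgHom.id ℂ (MaxTensorProduct A B)) := by
  obtain ⟨φ, hφ⟩ := hAB
  constructor
  -- No property of the lift has to be tracked, so the base element and the tolerance are arbitrary.
  · obtain ⟨ψ, hψ, -⟩ := hA.exists_lift_of_starHomotopic (FreeProduct.toTensor A B)
      (FreeProduct.denseRange_toTensor A B) hφ 1 one_pos (fun _ => True) (fun _ _ _ _ => trivial)
      (FreeProduct.inl A B) (NonUnitalStarAlgHom.ext fun a => FreeProduct.lift_inl _ _ a) trivial
    refine ⟨ψ.comp φ.symm.toNonUnitalStarAlgHom, NonUnitalStarAlgHom.ext fun x => ?_⟩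
    exact (DFunLike.congr_fun hψ (φ.symm x)).trans (φ.apply_symm_apply x)
  -- Semiprojectivity yields lifts that need not be unital. Tracking `ψ 1 = 1` with tolerance `1`
  -- repairs this, since `ψ' 1` is an idempotent at distance less than `1` from the unit.
  · obtain ⟨ψ, hψ, h1⟩ := hA.exists_lift_of_starHomotopic
      (UnitalFreeProduct.toTensor A B).toNonUnitalStarAlgHom
      (UnitalFreeProduct.denseRange_toTensor A B) hφ 1 one_pos (fun ψ => ψ 1 = 1)
      (fun ψ ψ' h h' => by
        rw [h] at h'
        refine IsIdempotentElem.eq_one_of_norm_sub_one_lt ?_ h'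
        rw [IsIdempotentElem, ← map_mul, one_mul])
      (UnitalFreeProduct.inl A B).toNonUnitalStarAlgHom
      (NonUnitalStarAlgHom.ext fun a => UnitalFreeProduct.lift_inl _ _ a)
      (map_one (UnitalFreeProduct.inl A B))
    refine ⟨(ψ.comp φ.symm.toNonUnitalStarAlgHom).toStarAlgHom ?_, StarAlgHom.ext fun x => ?_⟩
    · exact (congrArg ψ (map_one φ.symm)).trans h1
    · exact (DFunLike.congr_fun hψ (φ.symm x)).trans (φ.apply_symm_apply x)
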